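/- Consider the structured linear system $\dot x=[A]x+[B_{def}]u_{def}+[B_{att}]u_{att}$, where $[A]\in\{0,*\}^{n\times n}$, $[B_{def}]\in\{0,*\}^{n\times d}$, $[B_{att}]\in\{0,*\}^{n\times a}$; entries $0$ are fixed zeros and entries $*$ are free real parameters (which may take the value $0$). Let $\mathcal X=\{x_1,\dots,x_n\}$ be the set of states and let $\mathcal X_{def}$ (resp. $\mathcal X_{att}$) be the set of states $x_i$ for which row $i$ of $[B_{def}]$ (resp. $[B_{att}]$) contains a $*$; assume $\mathcal X_{def}\cap\mathcal X_{att}=\emptyset$. A pair $([A],[B])$ is structurally controllable if some real matrices $(A,B)$ that vanish at all fixed zeros form a controllable pair, i.e. for $\dot x=Ax+Bu$ every initial state can be transferred to every final state in finite time by some input. A denial-of-service (DoS) attack removes $u_{att}$; it is structurally successful if $([A],[B_{def}])$ is not structurally controllable. Let $\mathcal D([A])$ be the digraph on $\mathcal X$ with an edge $x_j\to x_i$ iff $[A]_{ij}=*$, and let $\mathcal D([A],[B_{def}])$ be the digraph obtained by adding the vertices of $u_{def}$ and an edge (link) $u_j\to x_i$ for each $[B_{def}]_{ij}=*$. Let $\mathcal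 B([A])$ be the bipartite graph with a left copy and a right copy of $\mathcal X$ and an edge from the left copy of $x_j$ to the right copy of $x_i$ iff $[A]_{ij}=*$; a right-unmatched vertex of a matching is a state whose right copy is not covered by it. A strongly connected component (SCC) of $\mathcal D([A])$ is non-top-linked if no edge enters it from outside. Let $\beta$ be the number of non-top-linked SCCs of $\mathcal D([A])$, and let $\alpha$ be the maximum, over all maximum matchings of $\mathcal B([A])$, of the number of non-top-linked SCCs that contain a right-unmatched vertex of the matching. Let $M$ be any maximum matching of $\mathcal B([A])$ and let $m_{def}$ be the number of right-unmatched vertices of $M$ that lie in $\mathcal X_{def}$. If $d\ge m_{def}$, then a DoS attack is structurally successful if any one of the following five conditions holds: 1. some state is not reachable in $\mathcal D([A],[B_{def}])$ from any vertex of $u_{def}$; 2. there is no family of pairwise vertex-disjoint simple paths with source in $u_{def}$ and cycles in $\mathcal D([A],[B_{def}])$ that together cover all states; 3. the number of links from $u_{def}$ to $\mathcal X$ is less than $m_{def}+\beta-\alpha$; 4. every maximum matching of $\mathcal B([A])$ has a right-unmatched vertex in $\mathcal X_{att}$; 5. some non-top-linked SCC of $\mathcal D([A])$ consists only of vertices of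 $\mathcal X_{att}$. -/

import Mathlib

namespace StructRes

/-! ### Structured matrices and structural controllability -/

/-- A structured matrix: `true` marks a free parameter `*`, `false` a fixed zero. -/
abbrev StructuredMatrix (ι κ : Type*) := Matrix ι κ Bool

/-- `M` is an admissible numerical realization of `H`: it vanishes at every fixed zero of `H`
(a free parameter may take any real value, including `0`). -/
def IsANR {ι κ : Type*} (H : StructuredMatrix ι κ) (M : Matrix ι κ ℝ) : Prop :=
  ∀ i j, H i j = false → M i j = 0

/-- `x` is the (Carathéodory) solution on `[0, T]` of `x' = A x + B u` with `x 0 = x₀`, where `u`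
is an integrable input on `[0, T]`. -/
def IsTrajectory {n p : ℕ} (A : Matrix (Fin n) (Fin n) ℝ) (B : Matrix (Fin n) (Fin p) ℝ)
    (T : ℝ) (x₀ : Fin n → ℝ) (u : ℝ → Fin p → ℝ) (x : ℝ → Fin n → ℝ) : Prop :=
  IntervalIntegrable u MeasureTheory.volume 0 T ∧
  ContinuousOn x (Set.Icc 0 T) ∧
  ∀ t ∈ Set.Icc (0 : ℝ) T,
    x t = x₀ + ∫ s in (0 : ℝ)..t, (A.mulVec (x s) + B.mulVec (u s))

/-- Controllability of `x' = A x + B u`: any initial state can be transferred to any final state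
in finite time by some input. -/
def IsControllable {n p : ℕ} (A : Matrix (Fin n) (Fin n) ℝ) (B : Matrix (Fin n) (Fin p) ℝ) :
    Prop :=
  ∀ x₀ x₁ : Fin n → ℝ, ∃ T : ℝ, 0 < T ∧ ∃ (u : ℝ → Fin p → ℝ) (x : ℝ → Fin n → ℝ),
    IsTrajectory A B T x₀ u x ∧ x T = x₁

/-- `([A],[B])` is structurally controllable: some numerical realization is controllable. -/
def StructurallyControllable {n p : ℕ} (A : StructuredMatrix (Fin n) (Fin n))
    (B : StructuredMatrix (Fin n) (Fin p)) : Prop :=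
  ∃ (A' : Matrix (Fin n) (Fin n) ℝ) (B' : Matrix (Fin n) (Fin p) ℝ),
    IsANR A A' ∧ IsANR B B' ∧ IsControllable A' B'

/-! ### Digraphs, paths, cycles, strongly connected components -/

/-- The digraph `D([A])` on the states, with an edge `x_j → x_i` iff `[A]_{ij} ≠ 0`. -/
def stateDigraph {n : ℕ} (A : StructuredMatrix (Fin n) (Fin n)) : Digraph (Fin n) where
  Adj j i := A i j = true

/-- The digraph `D([A],[B])` on inputs (`Sum.inl`) and states (`Sum.inr`), with edges
`x_j → x_i` iff `[A]_{ij} ≠ 0` and `u_j → x_i` iff `[B]_{ij} ≠ 0`. -/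
def systemDigraph {n p : ℕ} (A : StructuredMatrix (Fin n) (Fin n))
    (B : StructuredMatrix (Fin n) (Fin p)) : Digraph (Fin p ⊕ Fin n) where
  Adj
    | .inr j, .inr i => A i j = true
    | .inl j, .inr i => B i j = true
    | _, .inl _ => False

/-- A simple path, given by its (nonempty) list of vertices. -/
def IsSimplePath {V : Type*} (G : Digraph V) (l : List V) : Prop :=
  l ≠ [] ∧ l.Nodup ∧ l.IsChain G.Adj

/-- `l` is a simple path from `v` to `w`. -/
def IsSimplePathFrom {V : Type*} (G : Digraph V) (v w : V) (l : List V) : Prop :=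
  IsSimplePath G l ∧ l.head? = some v ∧ l.getLast? = some w

/-- A cycle: a simple path together with an edge from its last to its first vertex (for a
one-vertex list this is a self-loop). -/
def IsCycle {V : Type*} (G : Digraph V) (l : List V) : Prop :=
  IsSimplePath G l ∧ ∀ v ∈ l.getLast?, ∀ w ∈ l.head?, G.Adj v w

/-- `w` is reachable from `v`. -/
def Reachable {V : Type*} (G : Digraph V) (v w : V) : Prop :=
  ∃ l, IsSimplePathFrom G v w l

/-- A simple path whose source is an input vertex. -/
def IsInputRootedPath {n p : ℕ} (A : StructuredMatrix (Fin n) (Fin n))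
    (B : StructuredMatrix (Fin n) (Fin p)) (l : List (Fin p ⊕ Fin n)) : Prop :=
  IsSimplePath (systemDigraph A B) l ∧ ∃ j : Fin p, l.head? = some (Sum.inl j)

/-- All states are covered by the union of an input-rooted path family `P` and a cycle family `C`,
all of whose members are mutually vertex-disjoint. -/
def HasPathCycleCover {n p : ℕ} (A : StructuredMatrix (Fin n) (Fin n))
    (B : StructuredMatrix (Fin n) (Fin p)) : Prop :=
  ∃ P C : List (List (Fin p ⊕ Fin n)),
    (∀ l ∈ P, IsInputRootedPath A B l) ∧
    (∀ l ∈ C, IsCycle (systemDigraph A B) l) ∧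
    (P ++ C).Pairwise List.Disjoint ∧
    ∀ i : Fin n, ∃ l ∈ P ++ C, Sum.inr i ∈ l

/-- The subgraph induced on `S` is strongly connected. -/
def StronglyConnectedOn {V : Type*} (G : Digraph V) (S : Set V) : Prop :=
  ∀ v ∈ S, ∀ w ∈ S, ∃ l, IsSimplePathFrom G v w l ∧ ∀ z ∈ l, z ∈ S

/-- `S` is (the vertex set of) a strongly connected component. -/
def IsSCC {V : Type*} (G : Digraph V) (S : Set V) : Prop :=
  Maximal (fun T : Set V => T.Nonempty ∧ StronglyConnectedOn G T) S

/-- An SCC with no incoming edge from outside. -/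
def IsNonTopLinkedSCC {V : Type*} (G : Digraph V) (S : Set V) : Prop :=
  IsSCC G S ∧ ∀ w ∈ S, ∀ v, v ∉ S → ¬ G.Adj v w

/-! ### Matchings of the bipartite graph `B([A])` -/

/-- A matching of `B([A])`. The pair `(j, i)` stands for the edge from the left copy of `x_j` to
the right copy of `x_i`, present iff `[A]_{ij} ≠ 0`. -/
def IsMatching {n : ℕ} (A : StructuredMatrix (Fin n) (Fin n)) (M : Finset (Fin n × Fin n)) :
    Prop :=
  (∀ e ∈ M, A e.2 e.1 = true) ∧
  (∀ e ∈ M, ∀ f ∈ M, e.1 = f.1 → e = f) ∧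
  (∀ e ∈ M, ∀ f ∈ M, e.2 = f.2 → e = f)

/-- A matching with the largest number of edges. -/
def IsMaximumMatching {n : ℕ} (A : StructuredMatrix (Fin n) (Fin n))
    (M : Finset (Fin n × Fin n)) : Prop :=
  IsMatching A M ∧ ∀ N, IsMatching A N → N.card ≤ M.card

/-- The states whose right copy is not covered by `M`. -/
def rightUnmatched {n : ℕ} (M : Finset (Fin n × Fin n)) : Set (Fin n) :=
  {i | ∀ e ∈ M, e.2 ≠ i}

/-- `β`: the number of non-top-linked SCCs of `D([A])`. -/
noncomputable def numNonTopLinked {n : ℕ} (A : StructuredMatrix (Fin n) (Fin n)) : ℕ :=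
  Set.ncard {S : Set (Fin n) | IsNonTopLinkedSCC (stateDigraph A) S}

/-- The number of SCCs of `D([A])` that are top assignable with respect to `M`, that is,
non-top-linked and containing a right unmatched vertex of `M`. -/
noncomputable def numTopAssignable {n : ℕ} (A : StructuredMatrix (Fin n) (Fin n))
    (M : Finset (Fin n × Fin n)) : ℕ :=
  Set.ncard {S : Set (Fin n) | IsNonTopLinkedSCC (stateDigraph A) S ∧
    (S ∩ rightUnmatched M).Nonempty}

open Classical in
/-- `α`: the maximum top assignability index, the maximum of `numTopAssignable` over all maximum
matchings. -/
noncomputable def maxTopAssignability {n : ℕ} (A : StructuredMatrix (Fin n) (Fin n)) : ℕ :=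
  (Finset.univ.filter (IsMaximumMatching A)).sup (numTopAssignable A)

/-! ### Denial-of-service attacks -/

/-- The states directly linked to some input of `[B]` (this is `X_def` for `[B_def]` and `X_att`
for `[B_att]`). -/
def linkedStates {n p : ℕ} (B : StructuredMatrix (Fin n) (Fin p)) : Set (Fin n) :=
  {i | ∃ j, B i j = true}

/-- The number of links from the inputs of `[B]` to the states. -/
def numLinks {n p : ℕ} (B : StructuredMatrix (Fin n) (Fin p)) : ℕ :=
  (Finset.univ.filter fun e : Fin n × Fin p => B e.1 e.2 = true).card

/-- The structured system `x' = [A] x + [B_def] u_def + [B_att] u_att`. -/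
structure AttackableSystem (n d a : ℕ) where
  A : StructuredMatrix (Fin n) (Fin n)
  Bdef : StructuredMatrix (Fin n) (Fin d)
  Batt : StructuredMatrix (Fin n) (Fin a)

namespace AttackableSystem

variable {n d a : ℕ}

def Xdef (sys : AttackableSystem n d a) : Set (Fin n) := linkedStates sys.Bdef

def Xatt (sys : AttackableSystem n d a) : Set (Fin n) := linkedStates sys.Batt

/-- `m_def`: the number of right unmatched vertices, with respect to the matching `M`, that
lie in `X_def`. -/
noncomputable def mDef (sys : AttackableSystem n d a) (M : Finset (Fin n × Fin n)) : ℕ :=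
  Set.ncard (rightUnmatched M ∩ sys.Xdef)

/-- A DoS attack blocks `u_att`, which leaves the system `x' = [A] x + [B_def] u_def`. The attack
is structurally successful if this system is not structurally controllable. -/
def DoSSuccessful (sys : AttackableSystem n d a) : Prop :=
  ¬ StructurallyControllable sys.A sys.Bdef

end AttackableSystem

end StructRes

open StructRes

/-! Suppose a controllable realization `(A', B')` exists; each of the five conditions is then
refuted. If `C A' = Q C` and `C B' = 0`, then `C x` evolves autonomously, so a trajectory from `0`
keeps `C x = 0` and controllability forces `C = 0` (`IsControllable.eq_zero_of_mul_eq`). Two choices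
of `C` suffice.

With `C` a coordinate projection, no nonempty set of states is free of incoming edges and links.
Hence every state is reachable and every non-top-linked SCC meets `X_def`, against conditions 1 and
5.

With `C` a row vector, the rows of `[A' B']` are independent, so Hall's theorem gives each state its
own predecessor. Read as a permutation, this choice yields the path-cycle cover (condition 2). Read
as a matching, it extends to a maximum matching whose right-unmatched states all lie in `X_def`;
disjointness from `X_att` settles condition 4. For condition 3, these unmatched states, plus one
linked state in each non-top-linked SCC they miss, force enough links. -/

namespace StructRes

/-! ### Autonomous quotients and controllability -/

/-- A continuous solution of the linear integral equation `y = ∫ L y` vanishes. -/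
theorem eq_zero_of_eq_integral {E : Type*} [NormedAddCommGroup E] [NormedSpace ℝ E]
    [CompleteSpace E] (L : E →L[ℝ] E) {T : ℝ} (hT : 0 ≤ T) {y : ℝ → E}
    (hy : ContinuousOn y (Set.Icc 0 T))
    (h : ∀ t ∈ Set.Icc (0 : ℝ) T, y t = ∫ s in (0 : ℝ)..t, L (y s)) :
    ∀ t ∈ Set.Icc (0 : ℝ) T, y t = 0 := by
  -- Extending `y` continuously to all of `ℝ` makes its integral `w` differentiable everywhere;
  -- Grönwall with zero initial value then applies to `w`.
  set z : ℝ → E := Set.IccExtend hT ((Set.Icc 0 T).domRestrict y) with hz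
  have hzc : Continuous z := (continuousOn_iff_continuous_domRestrict.1 hy).Icc_extend'
  have hzy : ∀ t ∈ Set.Icc (0 : ℝ) T, z t = y t := fun t ht => by
    rw [hz, Set.IccExtend_of_mem hT _ ht]; rfl
  set w : ℝ → E := fun t => ∫ s in (0 : ℝ)..t, L (z s) with hw
  have hwd : ∀ t, HasDerivAt w (L (z t)) t := fun t =>
    ((L.continuous.comp hzc).integral_hasStrictDerivAt 0 t).hasDerivAt
  have hwy : ∀ t ∈ Set.Icc (0 : ℝ) T, w t = y t := fun t ht => by
    rw [h t ht]
    refine intervalIntegral.integral_congr fun s hs => ?_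
    rw [Set.uIcc_of_le ht.1] at hs
    simp only [hzy s ⟨hs.1, hs.2.trans ht.2⟩]
  intro t ht
  have key := norm_le_gronwallBound_of_norm_deriv_right_le (f := w) (f' := fun t => L (z t))
    (δ := 0) (K := ‖L‖) (ε := 0) (a := 0) (b := T)
    (fun t _ => (hwd t).continuousAt.continuousWithinAt) (fun t _ => (hwd t).hasDerivWithinAt)
    (by simp [hw]) (fun s hs => by
      have hs' : s ∈ Set.Icc (0 : ℝ) T := ⟨hs.1, hs.2.le⟩
      rw [hwy s hs', hzy s hs', add_zero]
      exact L.le_opNorm _) t ht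
  rw [gronwallBound_ε0_δ0, hwy t ht] at key
  exact norm_le_zero_iff.1 key

/-- A controllable pair has no nontrivial autonomous linear quotient. -/
theorem IsControllable.eq_zero_of_mul_eq {n p k : ℕ} {A : Matrix (Fin n) (Fin n) ℝ}
    {B : Matrix (Fin n) (Fin p) ℝ} (hc : IsControllable A B)
    {C : Matrix (Fin k) (Fin n) ℝ} {Q : Matrix (Fin k) (Fin k) ℝ}
    (hA : C * A = Q * C) (hB : C * B = 0) (v : Fin n → ℝ) : C.mulVec v = 0 := by
  obtain ⟨T, hT, u, x, ⟨hu, hx, hint⟩, rfl⟩ := hc 0 v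
  let cL {i j : ℕ} (P : Matrix (Fin i) (Fin j) ℝ) : (Fin j → ℝ) →L[ℝ] (Fin i → ℝ) :=
    P.mulVecLin.toContinuousLinearMap
  have hcL {i j : ℕ} (P : Matrix (Fin i) (Fin j) ℝ) (w : Fin j → ℝ) : cL P w = P.mulVec w := rfl
  refine eq_zero_of_eq_integral (cL Q) hT.le (y := fun t => C.mulVec (x t))
    ((cL C).continuous.comp_continuousOn hx) (fun t ht => ?_) T ⟨hT.le, le_rfl⟩
  have hxi : IntervalIntegrable x MeasureTheory.volume 0 t :=
    ContinuousOn.intervalIntegrable_of_Icc ht.1 (hx.mono (Set.Icc_subset_Icc_right ht.2))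
  have hui : IntervalIntegrable u MeasureTheory.volume 0 t :=
    hu.mono_set (by
      rw [Set.uIcc_of_le ht.1, Set.uIcc_of_le hT.le]; exact Set.Icc_subset_Icc_right ht.2)
  have hi : IntervalIntegrable (fun s => A.mulVec (x s) + B.mulVec (u s))
      MeasureTheory.volume 0 t :=
    IntervalIntegrable.add
      ⟨(cL A).integrable_comp hxi.1, (cL A).integrable_comp hxi.2⟩
      ⟨(cL B).integrable_comp hui.1, (cL B).integrable_comp hui.2⟩
  have h1 := (cL C).intervalIntegral_comp_comm hi
  simp only [hcL] at h1 ⊢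
  rw [hint t ht, zero_add, ← h1]
  refine intervalIntegral.integral_congr fun s _ => ?_
  simp only [Matrix.mulVec_add, Matrix.mulVec_mulVec, hA, hB, Matrix.zero_mulVec, add_zero]

variable {n p : ℕ} {A : StructuredMatrix (Fin n) (Fin n)} {B : StructuredMatrix (Fin n) (Fin p)}

/-- In a structurally controllable system, a set of states with no edge and no link entering it
is empty. -/
theorem StructurallyControllable.eq_empty_of_closed (hc : StructurallyControllable A B)
    {S : Set (Fin n)} (hA : ∀ i ∈ S, ∀ j, A i j = true → j ∈ S)
    (hB : ∀ i ∈ S, ∀ j, B i j = false) : S = ∅ := by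
  classical
  obtain ⟨A', B', hA', hB', hc⟩ := hc
  -- Projection onto the coordinates in `S`; the quotient dynamics is `Q = C * A'`.
  let C : Matrix (Fin n) (Fin n) ℝ := Matrix.diagonal fun i => if i ∈ S then 1 else 0
  have h1 : C * A' = C * A' * C := by
    ext i j
    simp only [C, Matrix.mul_diagonal, Matrix.diagonal_mul]
    by_cases hi : i ∈ S <;> by_cases hj : j ∈ S <;> simp [hi, hj]
    exact hA' i j (by by_contra h; exact hj (hA i hi j (by simpa using h)))
  have h2 : C * B' = 0 := by
    ext i j
    simp only [C, Matrix.diagonal_mul]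
    by_cases hi : i ∈ S <;> simp [hi]
    exact hB' i j (hB i hi j)
  refine Set.eq_empty_iff_forall_notMem.2 fun i hi => ?_
  have := congrFun (hc.eq_zero_of_mul_eq h1 h2 1) i
  simp [C, Matrix.mulVec_diagonal, hi] at this

/-- In a structurally controllable system, the states can be matched into the states and inputs
along edges and links. -/
theorem StructurallyControllable.exists_injective (hc : StructurallyControllable A B) :
    ∃ f : Fin n → Fin p ⊕ Fin n, Function.Injective f ∧
      ∀ i, (systemDigraph A B).Adj (f i) (Sum.inr i) := by
  classical
  obtain ⟨A', B', hA', hB', hc⟩ := hc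
  let t : Fin n → Finset (Fin p ⊕ Fin n) := fun i =>
    Finset.univ.filter fun c => (systemDigraph A B).Adj c (Sum.inr i)
  suffices h : ∀ s : Finset (Fin n), s.card ≤ (s.biUnion t).card by
    obtain ⟨f, hf, hft⟩ := (Finset.all_card_le_biUnion_card_iff_exists_injective t).1 h
    exact ⟨f, hf, fun i => by simpa [t] using hft i⟩
  intro s
  let G : Matrix (Fin n) (Fin p ⊕ Fin n) ℝ := Matrix.fromCols B' A'
  have hG : ∀ i c, c ∉ t i → G i c = 0 := by
    rintro i (j | j) h
    · exact hB' i j (Bool.eq_false_iff.2 fun hb => h (Finset.mem_filter.2 ⟨Finset.mem_univ _, hb⟩))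
    · exact hA' i j (Bool.eq_false_iff.2 fun hb => h (Finset.mem_filter.2 ⟨Finset.mem_univ _, hb⟩))
  -- Hall's condition is a dimension count: rows in `s` vanish outside the columns `s.biUnion t`, so
  -- their independence makes `φ` injective.
  let φ : (s → ℝ) →ₗ[ℝ] (s.biUnion t → ℝ) :=
    (G.submatrix (Subtype.val : s → Fin n) (Subtype.val : s.biUnion t → _)).vecMulLinear
  have hφ : Function.Injective φ := by
    rw [← LinearMap.ker_eq_bot, LinearMap.ker_eq_bot']
    intro w hw
    let v : Fin n → ℝ := fun i => if h : i ∈ s then w ⟨i, h⟩ else 0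
    have hv : ∀ c, ∑ i, v i * G i c = 0 := by
      intro c
      have h1 : ∑ i, v i * G i c = ∑ i : s, w i * G i c := by
        rw [← Finset.sum_subset (Finset.subset_univ s) (fun i _ hi => by simp [v, hi]),
          ← Finset.sum_coe_sort]
        exact Finset.sum_congr rfl fun i _ => by simp [v]
      rw [h1]
      by_cases hc : c ∈ s.biUnion t
      · exact congrFun hw ⟨c, hc⟩
      · refine Finset.sum_eq_zero fun i _ => ?_
        rw [hG i c fun h => hc (Finset.mem_biUnion.2 ⟨i, i.2, h⟩), mul_zero]
    -- A left null vector of `[B' A']` gives a conserved quantity, the case `Q = 0`.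
    let C : Matrix (Fin 1) (Fin n) ℝ := Matrix.of fun _ => v
    have hCA : C * A' = (0 : Matrix (Fin 1) (Fin 1) ℝ) * C := by
      ext i j
      simpa [Matrix.mul_apply, C, G] using hv (Sum.inr j)
    have hCB : C * B' = 0 := by
      ext i j
      simpa [Matrix.mul_apply, C, G] using hv (Sum.inl j)
    ext i
    have := congrFun (hc.eq_zero_of_mul_eq hCA hCB (Pi.single i 1)) 0
    simpa [C, v] using this
  simpa only [Module.finrank_fintype_fun_eq_card, Fintype.card_coe] using
    LinearMap.finrank_le_finrank_of_injective hφ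

/-! ### Maximum matchings -/

/-- The right vertices covered by a matching are covered by some maximum matching. -/
theorem IsMatching.exists_isMaximumMatching_rightUnmatched_subset
    {N₀ : Finset (Fin n × Fin n)} (h₀ : IsMatching A N₀) :
    ∃ N, IsMaximumMatching A N ∧ rightUnmatched N ⊆ rightUnmatched N₀ := by
  classical
  obtain ⟨K, hK, hKmax⟩ := (Finset.univ.filter (IsMatching A)).exists_max_image Finset.card
    ⟨N₀, by simpa using h₀⟩
  have hKM : IsMaximumMatching A K :=
    ⟨by simpa using hK, fun N hN => hKmax N (by simpa using hN)⟩
  -- Among maximum matchings, take one sharing the most edges with `N₀`. If it missed a right vertex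
  -- covered by `e ∈ N₀`, then inserting `e`, in place of any edge with the same left end, would
  -- increase the overlap or the size.
  obtain ⟨N, hN, hNmax⟩ := (Finset.univ.filter (IsMaximumMatching A)).exists_max_image
    (fun N => (N ∩ N₀).card) ⟨K, by simpa using hKM⟩
  replace hN : IsMaximumMatching A N := by simpa using hN
  refine ⟨N, hN, fun r hr e he her => ?_⟩
  have heN : e ∉ N := fun h => hr e h her
  -- Adding `e` to a submatching of `N` that avoids the left endpoint of `e` gives a matching.
  have hins : ∀ N' ⊆ N, (∀ g ∈ N', g.1 ≠ e.1) → IsMatching A (insert e N') := by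
    intro N' hN' hl
    refine ⟨?_, ?_, ?_⟩
    · intro g hg
      rcases Finset.mem_insert.1 hg with rfl | hg
      · exact h₀.1 _ he
      · exact hN.1.1 g (hN' hg)
    · intro g hg g' hg' h
      rcases Finset.mem_insert.1 hg with rfl | h1 <;> rcases Finset.mem_insert.1 hg' with rfl | h2
      · rfl
      · exact absurd h.symm (hl g' h2)
      · exact absurd h (hl g h1)
      · exact hN.1.2.1 g (hN' h1) g' (hN' h2) h
    · intro g hg g' hg' h
      rcases Finset.mem_insert.1 hg with rfl | h1 <;> rcases Finset.mem_insert.1 hg' with rfl | h2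
      · rfl
      · exact absurd (h.symm.trans her) (hr g' (hN' h2))
      · exact absurd (h.trans her) (hr g (hN' h1))
      · exact hN.1.2.2 g (hN' h1) g' (hN' h2) h
  by_cases hex : ∃ g ∈ N, g.1 = e.1
  · obtain ⟨g, hg, hge⟩ := hex
    have hg₀ : g ∉ N₀ := fun h => heN (h₀.2.1 g h e he hge ▸ hg)
    have hm : IsMatching A (insert e (N.erase g)) := by
      refine hins _ (Finset.erase_subset _ _) fun g' hg' h => ?_
      exact (Finset.mem_erase.1 hg').1
        (hN.1.2.1 g' (Finset.mem_erase.1 hg').2 g hg (h.trans hge.symm))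
    have hcard : (insert e (N.erase g)).card = N.card := by
      rw [Finset.card_insert_of_notMem fun h => heN (Finset.mem_erase.1 h).2,
        Finset.card_erase_add_one hg]
    have hle := hNmax (insert e (N.erase g)) (by
      simpa using ⟨hm, fun N' hN' => hcard ▸ hN.2 N' hN'⟩)
    have hsub : insert e (N ∩ N₀) ⊆ insert e (N.erase g) ∩ N₀ := by
      intro x hx
      rcases Finset.mem_insert.1 hx with rfl | hx
      · simp [he]
      · rw [Finset.mem_inter] at hx
        have : x ≠ g := fun h => hg₀ (h ▸ hx.2)
        simp [hx.1, hx.2, this]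
    have := Finset.card_le_card hsub
    rw [Finset.card_insert_of_notMem fun h => heN (Finset.mem_inter.1 h).1] at this
    omega
  · push Not at hex
    have := hN.2 _ (hins N subset_rfl hex)
    rw [Finset.card_insert_of_notMem heN] at this
    omega

/-- The states that an injective choice of predecessors assigns to states are covered by some
maximum matching. -/
theorem exists_isMaximumMatching_rightUnmatched_subset_linkedStates
    {f : Fin n → Fin p ⊕ Fin n} (hf : Function.Injective f)
    (hadj : ∀ i, (systemDigraph A B).Adj (f i) (Sum.inr i)) :
    ∃ N, IsMaximumMatching A N ∧ rightUnmatched N ⊆ linkedStates B := by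
  classical
  let N₀ : Finset (Fin n × Fin n) := Finset.univ.filter fun e => f e.2 = Sum.inr e.1
  have h₀ : IsMatching A N₀ := by
    refine ⟨fun e he => ?_, fun e he e' he' h => ?_, fun e he e' he' h => ?_⟩
    · have h := hadj e.2
      rw [(Finset.mem_filter.1 he).2] at h
      exact h
    · refine Prod.ext h (hf ?_)
      rw [(Finset.mem_filter.1 he).2, (Finset.mem_filter.1 he').2, h]
    · refine Prod.ext (Sum.inr_injective (β := Fin n) (α := Fin p) ?_) h
      rw [← (Finset.mem_filter.1 he).2, ← (Finset.mem_filter.1 he').2, h]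
  obtain ⟨N, hN, hsub⟩ := h₀.exists_isMaximumMatching_rightUnmatched_subset
  refine ⟨N, hN, fun i hi => ?_⟩
  have hi := hsub hi
  have h := hadj i
  -- A right-unmatched state cannot have a state as chosen predecessor, so it has an input.
  rcases hfi : f i with j | j
  · rw [hfi] at h
    exact ⟨j, h⟩
  · exact absurd rfl (hi (j, i) (by simp [N₀, hfi]))

theorem IsMatching.ncard_rightUnmatched {N : Finset (Fin n × Fin n)} (hN : IsMatching A N) :
    (rightUnmatched N).ncard + N.card = n := by
  classical
  have h1 : (rightUnmatched N)ᶜ = ((N.image Prod.snd : Finset (Fin n)) : Set (Fin n)) := by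
    ext i
    simp [rightUnmatched]
  have h2 : (N.image Prod.snd).card = N.card :=
    Finset.card_image_of_injOn fun e he e' he' h => hN.2.2 e he e' he' h
  have := Set.ncard_add_ncard_compl (rightUnmatched N)
  rwa [h1, Set.ncard_coe_finset, h2, Nat.card_eq_fintype_card, Fintype.card_fin] at this

theorem ncard_linkedStates_le : (linkedStates B).ncard ≤ numLinks B := by
  classical
  have h : linkedStates B ⊆ (((Finset.univ.filter fun e : Fin n × Fin p => B e.1 e.2 = true).image
      Prod.fst : Finset (Fin n)) : Set (Fin n)) := by
    rintro i ⟨j, hj⟩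
    simpa using ⟨j, hj⟩
  refine (Set.ncard_le_ncard h (Finset.finite_toSet _)).trans ?_
  rw [Set.ncard_coe_finset]
  exact Finset.card_image_le

/-! ### Reachability and non-top-linked components -/

/-- Reachability is closed under adding an edge. -/
theorem Reachable.step {V : Type*} {G : Digraph V} {u v w : V} (h : Reachable G u v)
    (hvw : G.Adj v w) : Reachable G u w := by
  obtain ⟨l, ⟨hne, hnd, hch⟩, hh, hl⟩ := h
  by_cases hw : w ∈ l
  · obtain ⟨l₁, l₂, rfl⟩ := List.append_of_mem hw
    have he : l₁ ++ w :: l₂ = (l₁ ++ [w]) ++ l₂ := by simp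
    refine ⟨l₁ ++ [w], ⟨by simp, ?_, ?_⟩, ?_, by simp⟩
    · rw [he] at hnd
      exact hnd.of_append_left
    · rw [he] at hch
      exact hch.left_of_append
    · cases l₁ <;> simpa using hh
  · refine ⟨l ++ [w], ⟨by simp, ?_, ?_⟩, ?_, by simp⟩
    · simp only [List.nodup_append, hnd, true_and]
      simp
      rintro a ha rfl
      exact hw ha
    · refine List.isChain_append.2 ⟨hch, by simp, ?_⟩
      intro x hx y hy
      rw [hl] at hx
      simp at hx hy
      subst hx hy
      exact hvw
    · simp [List.head?_append, hh]

theorem Reachable.refl {V : Type*} (G : Digraph V) (v : V) : Reachable G v v :=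
  ⟨[v], ⟨by simp, by simp, by simp⟩, by simp, by simp⟩

/-- A non-top-linked SCC contains every SCC that it meets. -/
theorem IsNonTopLinkedSCC.mem_of_mem {V : Type*} {G : Digraph V} {S T : Set V}
    (hS : IsNonTopLinkedSCC G S) (hT : IsNonTopLinkedSCC G T) {v : V} (hvS : v ∈ S)
    (hvT : v ∈ T) : T ⊆ S := by
  -- No edge enters `S`, so a path ending in `S` lies in `S` entirely.
  have pull : ∀ (l : List V) (w : V), l.IsChain G.Adj → l.getLast? = some w → w ∈ S →
      ∀ z ∈ l, z ∈ S := by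
    intro l
    induction l with
    | nil => simp
    | cons a l ih =>
      intro w hch hl hw z hz
      cases l with
      | nil =>
        simp at hl hz
        exact hz ▸ hl ▸ hw
      | cons b l =>
        rw [List.isChain_cons_cons] at hch
        have hmem := ih w hch.2 (by simpa using hl) hw
        rcases List.mem_cons.1 hz with rfl | hz
        · by_contra h
          exact hS.2 b (hmem b (by simp)) _ h hch.1
        · exact hmem z hz
  intro w hw
  obtain ⟨l, ⟨⟨_, _, hch⟩, hh, hl⟩, -⟩ := hT.1.prop.2 w hw v hvT
  exact pull l v hch hl hvS w (List.mem_of_mem_head? hh)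

/-- Distinct non-top-linked SCCs are disjoint. -/
theorem IsNonTopLinkedSCC.eq_of_mem {V : Type*} {G : Digraph V} {S T : Set V}
    (hS : IsNonTopLinkedSCC G S) (hT : IsNonTopLinkedSCC G T) {v : V} (hvS : v ∈ S)
    (hvT : v ∈ T) : S = T :=
  (hT.mem_of_mem hS hvT hvS).antisymm (hS.mem_of_mem hT hvS hvT)

/-- If the linked states contain the right-unmatched vertices of a maximum matching and meet
every non-top-linked SCC, then there are at least `m + β - α` of them. -/
theorem ncard_rightUnmatched_add_numNonTopLinked_le {N : Finset (Fin n × Fin n)}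
    (hN : IsMaximumMatching A N) {L : Set (Fin n)} (hNL : rightUnmatched N ⊆ L)
    (hL : ∀ S, IsNonTopLinkedSCC (stateDigraph A) S → (S ∩ L).Nonempty) :
    (rightUnmatched N).ncard + numNonTopLinked A ≤ L.ncard + maxTopAssignability A := by
  classical
  have hα : numTopAssignable A N ≤ maxTopAssignability A :=
    Finset.le_sup (f := numTopAssignable A) (by simpa using hN)
  set X : Set (Set (Fin n)) := {S | IsNonTopLinkedSCC (stateDigraph A) S} with hX
  set Y : Set (Set (Fin n)) := {S | IsNonTopLinkedSCC (stateDigraph A) S ∧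
    (S ∩ rightUnmatched N).Nonempty} with hY
  have hXY : (X \ Y).ncard + Y.ncard = X.ncard :=
    Set.ncard_sdiff_add_ncard_of_subset fun S hS => hS.1
  have hLN : (L \ rightUnmatched N).ncard + (rightUnmatched N).ncard = L.ncard :=
    Set.ncard_sdiff_add_ncard_of_subset hNL
  have hle : (X \ Y).ncard ≤ (L \ rightUnmatched N).ncard := by
    rcases (X \ Y).eq_empty_or_nonempty with h | ⟨S₀, hS₀⟩
    · simp [h]
    have : Nonempty (Fin n) := ⟨(hL S₀ hS₀.1).some⟩
    -- One linked state per SCC: for an SCC without unmatched vertices it lies outside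
    -- `rightUnmatched N`, and disjointness of the SCCs makes the choice injective.
    choose! g hg using hL
    refine Set.ncard_le_ncard_of_injOn g (fun S hS => ⟨(hg S hS.1).2, fun h => ?_⟩) ?_
    · exact hS.2 ⟨hS.1, g S, (hg S hS.1).1, h⟩
    · intro S hS S' hS' h
      exact IsNonTopLinkedSCC.eq_of_mem hS.1 hS'.1 (hg S hS.1).1 (h ▸ (hg S' hS'.1).1)
  change Y.ncard ≤ _ at hα
  change _ + X.ncard ≤ _
  omega

/-! ### Cutting the orbits of a permutation at a set -/

section ReturnTime

variable {V : Type*} [Finite V] (σ : Equiv.Perm V)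

theorem exists_pos_pow_apply_eq_self (v : V) : ∃ k, 0 < k ∧ (σ ^ k) v = v :=
  ⟨orderOf σ, orderOf_pos σ, by simp [pow_orderOf_eq_one]⟩

open Classical in
/-- The first time at which the orbit of `v` returns to `T`, or to `v`. -/
noncomputable def returnTime (T : Set V) (v : V) : ℕ :=
  Nat.find (p := fun k => 0 < k ∧ (σ ^ k) v ∈ insert v T)
    ((exists_pos_pow_apply_eq_self σ v).imp fun _ h => ⟨h.1, Or.inl h.2⟩)

/-- The orbit of `v` up to its return to `T`. -/
noncomputable def orbitSegment (T : Set V) (v : V) : List V :=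
  (List.range (returnTime σ T v)).map fun t => (σ ^ t) v

variable {σ} {T : Set V} {v w x : V}

theorem returnTime_pos : 0 < returnTime σ T v := by
  classical
  exact (Nat.find_spec (p := fun k => 0 < k ∧ (σ ^ k) v ∈ insert v T) _).1

theorem pow_returnTime_mem (hv : v ∈ T) : (σ ^ returnTime σ T v) v ∈ T := by
  classical
  have h : (σ ^ returnTime σ T v) v ∈ insert v T :=
    (Nat.find_spec (p := fun k => 0 < k ∧ (σ ^ k) v ∈ insert v T) _).2
  rwa [Set.insert_eq_of_mem hv] at h

theorem pow_apply_notMem {t : ℕ} (ht : 0 < t) (htk : t < returnTime σ T v) : (σ ^ t) v ∉ T := by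
  classical
  exact fun h => Nat.find_min _ htk ⟨ht, Or.inr h⟩

theorem mem_orbitSegment : x ∈ orbitSegment σ T v ↔ ∃ t < returnTime σ T v, (σ ^ t) v = x := by
  simp [orbitSegment]

/-- Cancelling `σ ^ s` would otherwise put the orbit of `w` at `v ∈ T` at the positive time `t - s`,
before its return. -/
theorem pow_apply_eq_imp (hv : v ∈ T) {s t : ℕ} (ht : t < returnTime σ T w) (hst : s ≤ t)
    (h : (σ ^ s) v = (σ ^ t) w) : s = t := by
  by_contra hne
  refine pow_apply_notMem (σ := σ) (T := T) (v := w) (t := t - s) (by omega) (by omega) ?_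
  have : v = (σ ^ (t - s)) w := by
    apply (σ ^ s).injective
    rw [h, ← Equiv.Perm.mul_apply, ← pow_add, Nat.add_sub_cancel' hst]
  rwa [← this]

theorem orbitSegment_disjoint (hv : v ∈ T) (hw : w ∈ T) (hvw : v ≠ w) :
    (orbitSegment σ T v).Disjoint (orbitSegment σ T w) := by
  intro x hxv hxw
  obtain ⟨s, hs, rfl⟩ := mem_orbitSegment.1 hxv
  obtain ⟨t, ht, h⟩ := mem_orbitSegment.1 hxw
  obtain rfl : s = t := by
    rcases le_total s t with hst | hst
    · exact pow_apply_eq_imp hv ht hst h.symm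
    · exact (pow_apply_eq_imp hw hs hst h).symm
  exact hvw ((σ ^ s).injective h.symm)

theorem orbitSegment_nodup (hv : v ∈ T) : (orbitSegment σ T v).Nodup := by
  refine List.nodup_range.map_on fun s hs t ht h => ?_
  rw [List.mem_range] at hs ht
  rcases le_total s t with hst | hst
  · exact pow_apply_eq_imp hv ht hst h
  · exact (pow_apply_eq_imp hv hs hst h.symm).symm

/-- Go back from `x` to `T` in the fewest steps: were the return time no larger than this number,
starting at the return point would be shorter. -/
theorem exists_mem_orbitSegment (hx : ∃ w ∈ T, σ.SameCycle w x) :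
    ∃ v ∈ T, x ∈ orbitSegment σ T v := by
  classical
  have hex : ∃ i : ℕ, ∃ w ∈ T, (σ ^ i) w = x := by
    obtain ⟨w, hw, hs⟩ := hx
    obtain ⟨i, hi⟩ := hs.exists_nat_pow_eq
    exact ⟨i, w, hw, hi⟩
  obtain ⟨w, hw, h⟩ := Nat.find_spec hex
  refine ⟨w, hw, mem_orbitSegment.2 ⟨Nat.find hex, ?_, h⟩⟩
  by_contra! hle
  have hpos : 0 < returnTime σ T w := returnTime_pos
  refine Nat.find_min hex (m := Nat.find hex - returnTime σ T w) (by omega)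
    ⟨_, pow_returnTime_mem (σ := σ) hw, ?_⟩
  rw [← Equiv.Perm.mul_apply, ← pow_add, Nat.sub_add_cancel hle, h]

theorem head?_orbitSegment : (orbitSegment σ T v).head? = some v := by
  obtain ⟨k, hk⟩ := Nat.exists_eq_add_one_of_ne_zero (returnTime_pos (σ := σ) (T := T) (v := v)).ne'
  simp [orbitSegment, hk, List.range_succ_eq_map]

theorem getLast?_orbitSegment :
    (orbitSegment σ T v).getLast? = some ((σ ^ (returnTime σ T v - 1)) v) := by
  obtain ⟨k, hk⟩ := Nat.exists_eq_add_one_of_ne_zero (returnTime_pos (σ := σ) (T := T) (v := v)).ne'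
  simp [orbitSegment, hk, List.range_succ]

theorem isSimplePath_orbitSegment {G : Digraph V} (hv : v ∈ T)
    (hG : ∀ x, σ x ∉ T → G.Adj x (σ x)) : IsSimplePath G (orbitSegment σ T v) := by
  refine ⟨fun h => ?_, orbitSegment_nodup hv, ?_⟩
  · have := head?_orbitSegment (σ := σ) (T := T) (v := v)
    simp [h] at this
  · rw [List.isChain_iff_getElem]
    intro i hi
    simp only [orbitSegment, List.length_map, List.length_range] at hi
    have h := pow_apply_notMem (Nat.succ_pos i) hi
    simp only [orbitSegment, List.getElem_map, List.getElem_range]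
    rw [pow_succ', Equiv.Perm.mul_apply] at h ⊢
    exact hG _ h

end ReturnTime

/-! ### Path-cycle covers -/

/-- An injective choice of predecessors yields a cover of the states by disjoint input-rooted
paths and cycles. -/
theorem hasPathCycleCover_of_injective {f : Fin n → Fin p ⊕ Fin n} (hf : Function.Injective f)
    (hadj : ∀ i, (systemDigraph A B).Adj (f i) (Sum.inr i)) : HasPathCycleCover A B := by
  classical
  -- `σ` maps each chosen predecessor `f i` to its state, so each of its steps into a state is an
  -- edge; only steps into inputs may fail to be. Cutting at the inputs leaves paths, and the orbits
  -- without inputs are cycles.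
  obtain ⟨σ, hσ⟩ := Equiv.Perm.exists_extending_pair f Sum.inr hf Sum.inr_injective
  have hG : ∀ x i, σ x = Sum.inr i → (systemDigraph A B).Adj x (σ x) := by
    intro x i h
    obtain rfl : x = f i := σ.injective (h.trans (hσ i).symm)
    rw [hσ]
    exact hadj i
  let I : Set (Fin p ⊕ Fin n) := Set.range Sum.inl
  -- One representative for each cycle of `σ` that avoids the inputs.
  let R : Set (Fin p ⊕ Fin n) := {v | (∀ w, σ.SameCycle v w → w ∉ I) ∧
    (Quotient.mk (Equiv.Perm.SameCycle.setoid σ) v).out = v}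
  let T : Set (Fin p ⊕ Fin n) := I ∪ R
  have hGT : ∀ x, σ x ∉ I → (systemDigraph A B).Adj x (σ x) := by
    intro x hx
    rcases h : σ x with j | i
    · exact absurd ⟨j, h.symm⟩ hx
    · rw [← h]
      exact hG x i h
  have hpath : ∀ v ∈ T, IsSimplePath (systemDigraph A B) (orbitSegment σ T v) := fun v hv =>
    isSimplePath_orbitSegment hv fun x hx => hGT x fun h => hx (Or.inl h)
  have hIR : Disjoint I R := Set.disjoint_left.2 fun v hI hR => hR.1 v (.refl σ v) hI
  refine ⟨I.toFinset.toList.map (orbitSegment σ T), R.toFinset.toList.map (orbitSegment σ T),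
    ?_, ?_, ?_, ?_⟩
  · intro l hl
    obtain ⟨v, hv, rfl⟩ := List.mem_map.1 hl
    have hv : v ∈ I := by simpa using hv
    obtain ⟨j, hj⟩ := hv
    exact ⟨hpath v (Or.inl ⟨j, hj⟩), j, by rw [head?_orbitSegment, hj]⟩
  · intro l hl
    obtain ⟨v, hv, rfl⟩ := List.mem_map.1 hl
    have hv : v ∈ R := by simpa using hv
    refine ⟨hpath v (Or.inr hv), ?_⟩
    intro x hx y hy
    rw [getLast?_orbitSegment, Option.mem_some_iff] at hx
    rw [head?_orbitSegment, Option.mem_some_iff] at hy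
    subst hx hy
    set k := returnTime σ T v with hk
    have hkpos : 0 < k := returnTime_pos
    have hs : σ.SameCycle v ((σ ^ k) v) := ⟨k, by simp⟩
    -- The orbit contains no input and only one representative, so its return to `T` is a return to
    -- `v`.
    have hret : (σ ^ k) v = v := by
      rcases pow_returnTime_mem (σ := σ) (T := T) (Or.inr hv) with h | h
      · exact absurd h (hv.1 _ hs)
      · rw [← h.2, ← hv.2]
        congr 1
        exact Quotient.sound (s := Equiv.Perm.SameCycle.setoid σ) (by rw [hv.2]; exact hs.symm)
    have hstep : σ ((σ ^ (k - 1)) v) = v := by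
      rw [← Equiv.Perm.mul_apply, ← pow_succ', Nat.sub_add_cancel hkpos, hret]
    have := hGT ((σ ^ (k - 1)) v) (by rw [hstep]; exact hv.1 v (.refl σ v))
    rwa [hstep] at this
  · rw [← List.map_append, List.pairwise_map]
    have hnd : (I.toFinset.toList ++ R.toFinset.toList).Nodup := by
      refine List.nodup_append.2 ⟨Finset.nodup_toList _, Finset.nodup_toList _, ?_⟩
      rintro a ha b hb rfl
      exact Set.disjoint_left.1 hIR (by simpa using ha) (by simpa using hb)
    have hT : ∀ v ∈ I.toFinset.toList ++ R.toFinset.toList, v ∈ T := by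
      intro v hv
      simpa [T] using hv
    exact hnd.imp_of_mem fun ha hb hab => orbitSegment_disjoint (hT _ ha) (hT _ hb) hab
  · intro i
    have hx : ∃ w ∈ T, σ.SameCycle w (Sum.inr i) := by
      by_cases h : ∃ w ∈ I, σ.SameCycle w (Sum.inr i)
      · obtain ⟨w, hw, hs⟩ := h
        exact ⟨w, Or.inl hw, hs⟩
      · push Not at h
        set q := Quotient.mk (Equiv.Perm.SameCycle.setoid σ) (Sum.inr i) with hq
        have hs : σ.SameCycle q.out (Sum.inr i) :=
          Quotient.exact (s := Equiv.Perm.SameCycle.setoid σ) (Quotient.out_eq q)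
        refine ⟨q.out, Or.inr ⟨fun w hw hI => h w hI (hw.symm.trans hs), ?_⟩, hs⟩
        rw [Quotient.out_eq]
    obtain ⟨v, hv, hmem⟩ := exists_mem_orbitSegment hx
    refine ⟨orbitSegment σ T v, ?_, hmem⟩
    rw [← List.map_append]
    exact List.mem_map_of_mem (by simpa [T] using hv)

/-! ### Consequences of structural controllability and conclusion -/

/-- In a structurally controllable system, every state is reachable from an input. -/
theorem StructurallyControllable.exists_reachable (hc : StructurallyControllable A B)
    (i : Fin n) : ∃ j, Reachable (systemDigraph A B) (Sum.inl j) (Sum.inr i) := by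
  by_contra! hi
  have hS := hc.eq_empty_of_closed
    (S := {i | ∀ j, ¬ Reachable (systemDigraph A B) (Sum.inl j) (Sum.inr i)})
    (fun i hi k hk j hr => hi j (hr.step hk))
    (fun i hi j => Bool.eq_false_iff.2 fun h => hi j ((Reachable.refl _ _).step h))
  exact Set.eq_empty_iff_forall_notMem.1 hS i hi

/-- In a structurally controllable system, every non-top-linked SCC contains a linked state. -/
theorem StructurallyControllable.inter_linkedStates_nonempty (hc : StructurallyControllable A B)
    {S : Set (Fin n)} (hS : IsNonTopLinkedSCC (stateDigraph A) S) :
    (S ∩ linkedStates B).Nonempty := by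
  by_contra h
  refine hS.1.prop.1.ne_empty (hc.eq_empty_of_closed (fun i hi j hj => ?_) fun i hi j => ?_)
  · by_contra hjS
    exact hS.2 i hi j hjS hj
  · exact Bool.eq_false_iff.2 fun hb => h ⟨i, hi, j, hb⟩

end StructRes

theorem mainTheorem6 (n d a : ℕ) (sys : AttackableSystem n d a)
    (hdisj : Disjoint sys.Xdef sys.Xatt)
    (M : Finset (Fin n × Fin n)) (hM : IsMaximumMatching sys.A M)
    (hd : sys.mDef M ≤ d)
    (h :
      (∃ i : Fin n, ∀ j : Fin d,
        ¬ Reachable (systemDigraph sys.A sys.Bdef) (Sum.inl j) (Sum.inr i)) ∨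
      (¬ HasPathCycleCover sys.A sys.Bdef) ∨
      ((numLinks sys.Bdef : ℤ) <
        (sys.mDef M : ℤ) + (numNonTopLinked sys.A : ℤ) - (maxTopAssignability sys.A : ℤ)) ∨
      (∀ N : Finset (Fin n × Fin n), IsMaximumMatching sys.A N →
        (rightUnmatched N ∩ sys.Xatt).Nonempty) ∨
      (∃ S : Set (Fin n), IsNonTopLinkedSCC (stateDigraph sys.A) S ∧ S ⊆ sys.Xatt)) :
    sys.DoSSuccessful := by
  intro hc
  obtain ⟨f, hf, hadj⟩ := hc.exists_injective
  obtain ⟨N, hN, hsub⟩ := exists_isMaximumMatching_rightUnmatched_subset_linkedStates hf hadj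
  rcases h with ⟨i, hi⟩ | h | h | h | ⟨S, hS, hSatt⟩
  · obtain ⟨j, hj⟩ := hc.exists_reachable i
    exact hi j hj
  · exact h (hasPathCycleCover_of_injective hf hadj)
  · have h1 := ncard_rightUnmatched_add_numNonTopLinked_le hN hsub
      fun S hS => hc.inter_linkedStates_nonempty hS
    -- `M` and `N` have equal size, hence equally many right-unmatched vertices, so the bound for
    -- `N` transfers to `M`.
    have h2 : sys.mDef M ≤ (rightUnmatched M).ncard := Set.ncard_le_ncard Set.inter_subset_left
    have h3 := hM.1.ncard_rightUnmatched
    have h4 := hN.1.ncard_rightUnmatched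
    have h5 := hM.2 N hN.1
    have h6 := hN.2 M hM.1
    have h7 := ncard_linkedStates_le (B := sys.Bdef)
    omega
  · obtain ⟨i, hi, hatt⟩ := h N hN
    exact Set.disjoint_left.1 hdisj (hsub hi) hatt
  · obtain ⟨i, hi, hdef⟩ := hc.inter_linkedStates_nonempty hS
    exact Set.disjoint_left.1 hdisj hdef (hSatt hi)
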